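/- Graphs are finite, simple, undirected and nonempty; $\alpha$ is the independence number, $\boxtimes$ the strong product, $G^{\boxtimes n}$ the $n$-fold strong product of $G$ with itself, and $$\alpha^*(G|H)=\sup_W \frac{\alpha(G\boxtimes W)}{\alpha(H\boxtimes W)}$$ (supremum over all nonempty finite graphs $W$) is the relative fractional independence number. Let $G$ and $H$ be graphs such that $G$ is vertex-transitive and there is a homomorphism from $H$ to $G$. Then $$\frac{\alpha(G)}{\alpha(H)}\le \alpha^*(G|H)\le\frac{|V(G)|}{|V(H)|},$$ which strengthens the No-Homomorphism Lemma $\frac{\alpha(G)}{\alpha(H)}\le\frac{|V(G)|}{|V(H)|}$. Moreover $$\frac{X(G)}{X(H)}\le\frac{|V(G)|}{|V(H)|}$$ where $X$ is any of the following invariants: the Shannon capacity $\lim_{n\to\infty}\alpha(G^{\boxtimes n})^{1/n}$; the fractional independence number $\max\sum_v w_v$ over all weightings $w\ge 0$ of $V(G)$ with $\sum_{v\in S}w_v\le1$ for every clique $S$; the Lovász number $\vartheta(G)=\max\{\sum_{u,v}X_{uv} : X\in\mathbb R^{V(G)\times V(G)},\ X\succeq0,\ \operatorname{tr}X=1,\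 X_{uv}=0 \text{ for } uv\in E(G)\}$; Schrijver's variant $\vartheta^-(G)$, where in addition $X_{uv}\ge0$ for all $u,v$; Szegedy's variant $\vartheta^+(G)$, where the condition $X_{uv}=0$ for $uv\in E(G)$ is relaxed to $X_{uv}\le0$. -/

import Mathlib

open Filter Topology

namespace SimpleGraph

/-- `G` is vertex-transitive: any vertex is mapped to any other one by an automorphism. -/
def IsVertexTransitive {V : Type*} (G : SimpleGraph V) : Prop :=
  ∀ u v : V, ∃ φ : G ≃g G, φ u = v

/-- The strong product `G ⊠ H`. -/
def strongProd {V W : Type*} (G : SimpleGraph V) (H : SimpleGraph W) : SimpleGraph (V × W) where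
  Adj x y := (x.1 = y.1 ∧ H.Adj x.2 y.2) ∨ (G.Adj x.1 y.1 ∧ x.2 = y.2) ∨
    (G.Adj x.1 y.1 ∧ H.Adj x.2 y.2)
  symm.symm x y := by simp [eq_comm, adj_comm]
  loopless.irrefl x := by simp

/-- The `n`-fold strong product `G ⊠ ⋯ ⊠ G`, on the vertex set `V ^ n`: distinct words are adjacent
iff in every position their letters are equal or adjacent. -/
def strongPow {V : Type*} (G : SimpleGraph V) (n : ℕ) : SimpleGraph (Fin n → V) where
  Adj x y := x ≠ y ∧ ∀ i, x i = y i ∨ G.Adj (x i) (y i)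
  symm.symm x y := by simp [eq_comm, adj_comm]
  loopless.irrefl x := by simp

/-- The relative fractional independence number `α*(G|H) = sup_W α(G ⊠ W) / α(H ⊠ W)`, the supremum
over all nonempty finite graphs `W` (each is isomorphic to a graph on some `Fin (n + 1)`), taken in
the extended nonnegative reals. -/
noncomputable def relFracIndepNum {V W : Type*} (G : SimpleGraph V) (H : SimpleGraph W) : ENNReal :=
  ⨆ (n : ℕ) (K : SimpleGraph (Fin (n + 1))),
    ((G.strongProd K).indepNum : ENNReal) / ((H.strongProd K).indepNum : ENNReal)

/-- The Shannon capacity `lim_n α(G^{⊠ n})^{1/n}`. -/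
noncomputable def shannonCapacity {V : Type*} (G : SimpleGraph V) : ℝ :=
  limUnder atTop (fun n : ℕ => ((G.strongPow n).indepNum : ℝ) ^ (1 / (n : ℝ)))

/-- The fractional independence number: the maximal total weight of a nonnegative weighting of the
vertices in which every clique has weight at most `1`. -/
noncomputable def fracIndepNum {V : Type*} [Fintype V] (G : SimpleGraph V) : ℝ :=
  sSup {t : ℝ | ∃ w : V → ℝ, (∀ v, 0 ≤ w v) ∧
    (∀ S : Finset V, G.IsClique (S : Set V) → ∑ v ∈ S, w v ≤ 1) ∧ t = ∑ v, w v}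

/-- The Lovász number: the maximum of `⟨J, X⟩` over real positive semidefinite `X` with trace `1`
that vanish on the edges of `G`. -/
noncomputable def lovaszTheta {V : Type*} [Fintype V] (G : SimpleGraph V) : ℝ :=
  sSup {t : ℝ | ∃ X : Matrix V V ℝ, X.PosSemidef ∧ X.trace = 1 ∧
    (∀ u v, G.Adj u v → X u v = 0) ∧ t = ∑ u, ∑ v, X u v}

/-- Schrijver's variant `ϑ⁻` of the Lovász number: the matrix is moreover entrywise nonnegative. -/
noncomputable def schrijverTheta {V : Type*} [Fintype V] (G : SimpleGraph V) : ℝ :=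
  sSup {t : ℝ | ∃ X : Matrix V V ℝ, X.PosSemidef ∧ X.trace = 1 ∧
    (∀ u v, G.Adj u v → X u v = 0) ∧ (∀ u v, 0 ≤ X u v) ∧ t = ∑ u, ∑ v, X u v}

/-- Szegedy's variant `ϑ⁺` of the Lovász number: the matrix need only be nonpositive, instead of
zero, on the edges of `G`. -/
noncomputable def szegedyTheta {V : Type*} [Fintype V] (G : SimpleGraph V) : ℝ :=
  sSup {t : ℝ | ∃ X : Matrix V V ℝ, X.PosSemidef ∧ X.trace = 1 ∧
    (∀ u v, G.Adj u v → X u v ≤ 0) ∧ t = ∑ u, ∑ v, X u v}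

/-! The limit that defines the Shannon capacity exists. -/

theorem strongPow_indepNum_pos {V : Type*} [Finite V] [Nonempty V] (G : SimpleGraph V) (n : ℕ) :
    1 ≤ (G.strongPow n).indepNum := by
  obtain ⟨v⟩ := ‹Nonempty V›
  have h : (G.strongPow n).IsIndepSet (({fun _ => v} : Finset (Fin n → V)) : Set (Fin n → V)) := by
    simp [isIndepSet_iff]
  simpa using h.card_le_indepNum

theorem strongPow_indepNum_le {V : Type*} [Fintype V] (G : SimpleGraph V) (n : ℕ) :
    (G.strongPow n).indepNum ≤ Fintype.card V ^ n := by
  classical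
  obtain ⟨s, hs⟩ := (G.strongPow n).exists_isNIndepSet_indepNum
  rw [← hs.card_eq]
  simpa using s.card_le_univ

theorem strongPow_indepNum_mul_le {V : Type*} [Finite V] (G : SimpleGraph V) (m n : ℕ) :
    (G.strongPow m).indepNum * (G.strongPow n).indepNum ≤ (G.strongPow (m + n)).indepNum := by
  classical
  obtain ⟨s, hs⟩ := (G.strongPow m).exists_isNIndepSet_indepNum
  obtain ⟨t, ht⟩ := (G.strongPow n).exists_isNIndepSet_indepNum
  rw [← hs.card_eq, ← ht.card_eq, ← Finset.card_product,
    ← Finset.card_map (Fin.appendEquiv (α := V) m n).toEmbedding]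
  apply IsIndepSet.card_le_indepNum
  intro x hx y hy hxy hadj
  simp only [Finset.coe_map, Set.mem_image, Finset.mem_coe, Finset.mem_product] at hx hy
  obtain ⟨⟨a, b⟩, ⟨ha, hb⟩, rfl⟩ := hx
  obtain ⟨⟨c, d⟩, ⟨hc, hd⟩, rfl⟩ := hy
  have key := hadj.2
  have h1 : ∀ i, a i = c i ∨ G.Adj (a i) (c i) := fun i => by
    simpa [Fin.appendEquiv] using key (Fin.castAdd n i)
  have h2 : ∀ i, b i = d i ∨ G.Adj (b i) (d i) := fun i => by
    simpa [Fin.appendEquiv] using key (Fin.natAdd m i)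
  have hac : a = c := by
    by_contra hne
    exact hs.isIndepSet ha hc hne ⟨hne, h1⟩
  have hbd : b = d := by
    by_contra hne
    exact ht.isIndepSet hb hd hne ⟨hne, h2⟩
  exact hxy (by rw [hac, hbd])

theorem tendsto_shannonCapacity {V : Type*} [Finite V] [Nonempty V] (G : SimpleGraph V) :
    Tendsto (fun n : ℕ => ((G.strongPow n).indepNum : ℝ) ^ (1 / (n : ℝ))) atTop
      (𝓝 G.shannonCapacity) := by
  have := Fintype.ofFinite V
  have hpos : ∀ n, (0 : ℝ) < (G.strongPow n).indepNum := fun n => by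
    exact_mod_cast G.strongPow_indepNum_pos n
  have hsub : Subadditive (fun n => -Real.log (G.strongPow n).indepNum) := fun m n => by
    have h : ((G.strongPow m).indepNum : ℝ) * (G.strongPow n).indepNum ≤
        (G.strongPow (m + n)).indepNum := by exact_mod_cast G.strongPow_indepNum_mul_le m n
    have h' := Real.log_le_log (mul_pos (hpos m) (hpos n)) h
    rw [Real.log_mul (hpos m).ne' (hpos n).ne'] at h'
    linarith
  have hbdd : BddBelow (Set.range fun n : ℕ => -Real.log (G.strongPow n).indepNum / n) := by
    refine ⟨-Real.log (Fintype.card V), ?_⟩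
    rintro _ ⟨n, rfl⟩
    have hc : (0 : ℝ) ≤ Real.log (Fintype.card V) := Real.log_natCast_nonneg _
    rcases Nat.eq_zero_or_pos n with rfl | hn
    · simpa using hc
    · have hn' : (0 : ℝ) < n := by exact_mod_cast hn
      have h : ((G.strongPow n).indepNum : ℝ) ≤ (Fintype.card V : ℝ) ^ n := by
        exact_mod_cast G.strongPow_indepNum_le n
      have h' := Real.log_le_log (hpos n) h
      rw [Real.log_pow] at h'
      rw [le_div_iff₀ hn']
      linarith
  have hlim := (Real.continuous_exp.tendsto _).comp (hsub.tendsto_lim hbdd).neg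
  refine tendsto_nhds_limUnder ⟨_, hlim.congr fun n => ?_⟩
  rw [Function.comp_apply, Real.rpow_def_of_pos (hpos n)]
  congr 1
  ring

end SimpleGraph

/-! Fix `φ : H →g G`. By transitivity, a uniformly random automorphism `σ` sends each `φ w` to a
uniformly random vertex of `G`, so the expected sum of `f` along the homomorphism `σ ∘ φ` is `|W|`
times the mean of `f`. A bound valid along every homomorphism therefore bounds the mean: this is
`card_mul_sum_le`.

Independent sets and clique-constrained weightings pull back along homomorphisms, which settles the
relative and fractional numbers. Strong powers inherit transitivity and the homomorphism, so the
Shannon capacity follows by taking `n`-th roots. For the theta variants, pulled-back matrices are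
averaged over the automorphisms; the trace is controlled by the same averaging, the objective by
Cauchy–Schwarz (`exists_posSemidef`). -/

namespace SimpleGraph

/-! ### Averaging over the automorphism group. -/

section Averaging

variable {V W : Type*} [Fintype V] {G : SimpleGraph V} {H : SimpleGraph W}

/-- The average of a function over the orbit of a vertex is its average over all vertices. -/
theorem IsVertexTransitive.card_mul_sum_aut (hG : G.IsVertexTransitive) [Fintype (G ≃g G)]
    (f : V → ℝ) (v : V) :
    (Fintype.card V : ℝ) * ∑ σ : G ≃g G, f (σ v) = Fintype.card (G ≃g G) * ∑ u, f u := by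
  -- Right translation by `τ` permutes the automorphism group.
  have hconst : ∀ u, ∑ σ : G ≃g G, f (σ u) = ∑ σ : G ≃g G, f (σ v) := fun u => by
    obtain ⟨τ, rfl⟩ := hG v u
    exact Fintype.sum_equiv (Equiv.mulRight τ) _ _ fun σ => rfl
  calc (Fintype.card V : ℝ) * ∑ σ : G ≃g G, f (σ v)
      = ∑ u, ∑ σ : G ≃g G, f (σ u) := by simp [hconst]
    _ = ∑ σ : G ≃g G, ∑ u, f (σ u) := Finset.sum_comm
    _ = ∑ _σ : G ≃g G, ∑ u, f u :=
        Finset.sum_congr rfl fun σ _ => Equiv.sum_comp σ.toEquiv f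
    _ = _ := by simp

theorem IsVertexTransitive.card_mul_sum_aut_sum [Fintype W] (hG : G.IsVertexTransitive)
    [Fintype (G ≃g G)] (f : V → ℝ) (φ : W → V) :
    (Fintype.card V : ℝ) * ∑ σ : G ≃g G, ∑ w, f (σ (φ w)) =
      Fintype.card (G ≃g G) * (Fintype.card W * ∑ u, f u) := by
  rw [Finset.sum_comm, Finset.mul_sum]
  simp only [hG.card_mul_sum_aut, Finset.sum_const, Finset.card_univ, nsmul_eq_mul]
  ring

/-- If a function on `V` has sum at most `c` along every homomorphism from `H` to `G`, then its
average over `V` is at most `c / |W|`. -/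
theorem IsVertexTransitive.card_mul_sum_le [Fintype W] (hG : G.IsVertexTransitive) (φ : H →g G)
    (f : V → ℝ) (c : ℝ) (hc : ∀ ψ : H →g G, ∑ w, f (ψ w) ≤ c) :
    (Fintype.card W : ℝ) * ∑ v, f v ≤ Fintype.card V * c := by
  have : Finite (G ≃g G) := DFunLike.finite _
  have := Fintype.ofFinite (G ≃g G)
  have hpos : (0 : ℝ) < Fintype.card (G ≃g G) := by exact_mod_cast Fintype.card_pos
  refine le_of_mul_le_mul_left ?_ hpos
  rw [← hG.card_mul_sum_aut_sum f φ]
  calc (Fintype.card V : ℝ) * ∑ σ : G ≃g G, ∑ w, f (σ (φ w))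
      ≤ Fintype.card V * ∑ _σ : G ≃g G, c := by
        gcongr with σ
        exact hc (σ.toHom.comp φ)
    _ = _ := by simp; ring

end Averaging

/-! ### Independence numbers of strong products. -/

section Independence

variable {V W K : Type*}

theorem Embedding.indepNum_le [Finite V] [Finite W] {G : SimpleGraph V} {H : SimpleGraph W}
    (f : G ↪g H) : G.indepNum ≤ H.indepNum := by
  obtain ⟨s, hs⟩ := G.exists_isNIndepSet_indepNum
  rw [← hs.card_eq, ← Finset.card_map f.toEmbedding]
  apply IsIndepSet.card_le_indepNum
  intro x hx y hy hxy hadj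
  simp only [Finset.coe_map, Set.mem_image, Finset.mem_coe] at hx hy
  obtain ⟨a, ha, rfl⟩ := hx
  obtain ⟨b, hb, rfl⟩ := hy
  exact hs.isIndepSet ha hb (fun h => hxy (h ▸ rfl)) (f.map_adj_iff.1 hadj)

/-- The strong product with a one-vertex graph. -/
def strongProdUnique [Unique K] (G : SimpleGraph V) (L : SimpleGraph K) :
    G.strongProd L ≃g G where
  toEquiv := Equiv.prodUnique V K
  map_rel_iff' {x y} := by
    have h : x.2 = y.2 := Subsingleton.elim _ _
    simp [strongProd, h]

theorem indepNum_strongProd_unique [Finite V] [Unique K] (G : SimpleGraph V) (L : SimpleGraph K) :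
    (G.strongProd L).indepNum = G.indepNum :=
  le_antisymm (strongProdUnique G L).toEmbedding.indepNum_le
    (strongProdUnique G L).symm.toEmbedding.indepNum_le

theorem sum_sum_ite_mem [Fintype V] [Fintype K] [DecidableEq (V × K)] (t : Finset (V × K)) :
    ∑ v, ∑ k, (if (v, k) ∈ t then (1 : ℝ) else 0) = t.card := by
  rw [← Fintype.sum_prod_type']
  simp

/-- The No-Homomorphism Lemma for strong products with a fixed graph. -/
theorem IsVertexTransitive.card_mul_indepNum_strongProd_le [Fintype V] [Fintype W] [Fintype K]
    {G : SimpleGraph V} {H : SimpleGraph W} (hG : G.IsVertexTransitive) (φ : H →g G)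
    (L : SimpleGraph K) :
    Fintype.card W * (G.strongProd L).indepNum ≤ Fintype.card V * (H.strongProd L).indepNum := by
  classical
  obtain ⟨s, hs⟩ := (G.strongProd L).exists_isNIndepSet_indepNum
  -- The averaged function is the size of the fibre of `s` over `v`.
  have key := hG.card_mul_sum_le φ (fun v => ∑ k, if (v, k) ∈ s then (1 : ℝ) else 0)
    (H.strongProd L).indepNum fun ψ => by
      -- The preimage of `s` under `ψ × id` is independent: adjacent pairs have adjacent, hence
      -- distinct, images, even if `ψ` is not injective.
      let t : Finset (W × K) := Finset.univ.filter fun x => (ψ x.1, x.2) ∈ s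
      have ht : (H.strongProd L).IsIndepSet (t : Set (W × K)) := by
        intro x hx y hy _ hadj
        simp only [t, Finset.coe_filter, Finset.mem_univ, true_and, Set.mem_ofPred_eq] at hx hy
        have h : (G.strongProd L).Adj (ψ x.1, x.2) (ψ y.1, y.2) := by
          rcases hadj with ⟨h1, h2⟩ | ⟨h1, h2⟩ | ⟨h1, h2⟩
          · exact Or.inl ⟨congrArg ψ h1, h2⟩
          · exact Or.inr (Or.inl ⟨ψ.map_adj h1, h2⟩)
          · exact Or.inr (Or.inr ⟨ψ.map_adj h1, h2⟩)
        exact hs.isIndepSet hx hy h.ne h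
      have h := sum_sum_ite_mem t
      simp only [t, Finset.mem_filter, Finset.mem_univ, true_and] at h
      rw [h]
      exact_mod_cast ht.card_le_indepNum
  rw [sum_sum_ite_mem s, hs.card_eq] at key
  exact_mod_cast key

/-- The No-Homomorphism Lemma. -/
theorem IsVertexTransitive.card_mul_indepNum_le [Fintype V] [Fintype W]
    {G : SimpleGraph V} {H : SimpleGraph W} (hG : G.IsVertexTransitive) (φ : H →g G) :
    Fintype.card W * G.indepNum ≤ Fintype.card V * H.indepNum := by
  simpa only [indepNum_strongProd_unique] using
    hG.card_mul_indepNum_strongProd_le φ (⊥ : SimpleGraph Unit)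

theorem indepNum_div_le_relFracIndepNum [Finite V] [Finite W] (G : SimpleGraph V)
    (H : SimpleGraph W) :
    (G.indepNum : ENNReal) / (H.indepNum : ENNReal) ≤ G.relFracIndepNum H := by
  -- Index `0` is the one-vertex graph, for which the ratio is `α(G) / α(H)`.
  have h := le_iSup₂ (f := fun (n : ℕ) (K : SimpleGraph (Fin (n + 1))) =>
    ((G.strongProd K).indepNum : ENNReal) / ((H.strongProd K).indepNum : ENNReal)) 0 ⊥
  have : Unique (Fin (0 + 1)) := inferInstanceAs (Unique (Fin 1))
  rwa [indepNum_strongProd_unique, indepNum_strongProd_unique] at h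

theorem IsVertexTransitive.relFracIndepNum_le [Fintype V] [Fintype W] [Nonempty W]
    {G : SimpleGraph V} {H : SimpleGraph W} (hG : G.IsVertexTransitive) (φ : H →g G) :
    G.relFracIndepNum H ≤ (Fintype.card V : ENNReal) / (Fintype.card W : ENNReal) := by
  refine iSup₂_le fun n K => ENNReal.div_le_of_le_mul ?_
  have h : (Fintype.card W : ENNReal) * (G.strongProd K).indepNum ≤
      Fintype.card V * (H.strongProd K).indepNum := by
    exact_mod_cast hG.card_mul_indepNum_strongProd_le φ K
  rw [div_eq_mul_inv, mul_right_comm, ← div_eq_mul_inv,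
    ENNReal.le_div_iff_mul_le (by simp) (by simp), mul_comm]
  exact h

end Independence

/-! ### Strong powers and the Shannon capacity. -/

section ShannonCapacity

variable {V W : Type*} {G : SimpleGraph V} {H : SimpleGraph W}

/-- A homomorphism acts letterwise on strong powers. -/
def Hom.strongPow (φ : H →g G) (n : ℕ) : H.strongPow n →g G.strongPow n where
  toFun x i := φ (x i)
  map_rel' {x y} h := by
    refine ⟨fun heq => ?_, fun i => (h.2 i).imp (congrArg φ) φ.map_adj⟩
    obtain ⟨i, hi⟩ := Function.ne_iff.1 h.1
    exact (φ.map_adj ((h.2 i).resolve_left hi)).ne (congrFun heq i)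

theorem IsVertexTransitive.strongPow (hG : G.IsVertexTransitive) (n : ℕ) :
    (G.strongPow n).IsVertexTransitive := by
  intro u v
  choose σ hσ using fun i => hG (u i) (v i)
  refine ⟨⟨Equiv.piCongrRight fun i => (σ i).toEquiv, fun {x y} => ?_⟩, funext hσ⟩
  have h : ∀ i, (σ i) (x i) = (σ i) (y i) ∨ G.Adj ((σ i) (x i)) ((σ i) (y i)) ↔
      x i = y i ∨ G.Adj (x i) (y i) := fun i => by
    rw [(σ i).injective.eq_iff, (σ i).map_adj_iff]
  exact and_congr (Equiv.injective _).ne_iff (forall_congr' h)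

theorem IsVertexTransitive.shannonCapacity_le [Fintype V] [Fintype W] [Nonempty W]
    (hG : G.IsVertexTransitive) (φ : H →g G) :
    G.shannonCapacity ≤ (Fintype.card V : ℝ) / Fintype.card W * H.shannonCapacity := by
  have : Nonempty V := ‹Nonempty W›.map φ
  refine le_of_tendsto_of_tendsto G.tendsto_shannonCapacity
    (H.tendsto_shannonCapacity.const_mul _) ?_
  -- At `n = 0` the exponent `1 / n` is `0`, so the root would not undo the power.
  filter_upwards [eventually_ge_atTop 1] with n hn
  have hW : (0 : ℝ) < Fintype.card W := by exact_mod_cast Fintype.card_pos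
  have h : (Fintype.card W : ℝ) ^ n * (G.strongPow n).indepNum ≤
      (Fintype.card V : ℝ) ^ n * (H.strongPow n).indepNum := by
    have := (hG.strongPow n).card_mul_indepNum_le (φ.strongPow n)
    simp only [Fintype.card_fun, Fintype.card_fin] at this
    exact_mod_cast this
  have h' : ((G.strongPow n).indepNum : ℝ) ≤
      ((Fintype.card V : ℝ) / Fintype.card W) ^ n * (H.strongPow n).indepNum := by
    rw [div_pow, div_mul_eq_mul_div, le_div_iff₀ (by positivity), mul_comm]
    exact h
  calc ((G.strongPow n).indepNum : ℝ) ^ (1 / (n : ℝ))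
      ≤ (((Fintype.card V : ℝ) / Fintype.card W) ^ n * (H.strongPow n).indepNum) ^
          (1 / (n : ℝ)) := by gcongr
    _ = _ := by
      rw [Real.mul_rpow (by positivity) (by positivity), one_div,
        Real.pow_rpow_inv_natCast (by positivity) (by omega)]

theorem shannonCapacity_nonneg [Finite V] [Nonempty V] (G : SimpleGraph V) :
    0 ≤ G.shannonCapacity :=
  ge_of_tendsto' G.tendsto_shannonCapacity fun _ => by positivity

end ShannonCapacity

/-! ### The fractional independence number. -/

section FractionalIndependence

variable {V W : Type*} [Fintype V] [Fintype W] {G : SimpleGraph V} {H : SimpleGraph W}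

theorem fracIndepNum_nonneg (G : SimpleGraph V) : 0 ≤ G.fracIndepNum := by
  refine Real.sSup_nonneg ?_
  rintro _ ⟨w, hw, -, rfl⟩
  exact Finset.sum_nonneg fun v _ => hw v

theorem sum_le_fracIndepNum (G : SimpleGraph V) {w : V → ℝ} (hw : ∀ v, 0 ≤ w v)
    (hS : ∀ S : Finset V, G.IsClique (S : Set V) → ∑ v ∈ S, w v ≤ 1) :
    ∑ v, w v ≤ G.fracIndepNum := by
  refine le_csSup ⟨Fintype.card V, ?_⟩ ⟨w, hw, hS, rfl⟩
  rintro _ ⟨w, -, hS, rfl⟩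
  calc ∑ v, w v ≤ ∑ _v : V, (1 : ℝ) :=
        Finset.sum_le_sum fun v _ => by simpa using hS {v} (by simp)
    _ = _ := by simp

theorem IsVertexTransitive.fracIndepNum_le [Nonempty W] (hG : G.IsVertexTransitive) (φ : H →g G) :
    G.fracIndepNum ≤ (Fintype.card V : ℝ) / Fintype.card W * H.fracIndepNum := by
  classical
  have hW : (0 : ℝ) < Fintype.card W := by exact_mod_cast Fintype.card_pos
  refine Real.sSup_le ?_ (mul_nonneg (by positivity) H.fracIndepNum_nonneg)
  rintro _ ⟨w, hw, hS, rfl⟩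
  rw [div_mul_eq_mul_div, le_div_iff₀ hW, mul_comm]
  refine hG.card_mul_sum_le φ w _ fun ψ => H.sum_le_fracIndepNum (fun x => hw _) fun S hSc => ?_
  -- A homomorphism is injective on cliques, so the image clique carries the same total weight.
  have hinj : Set.InjOn ψ (S : Set W) := fun x hx y hy hxy => by
    by_contra hne
    exact (ψ.map_adj (hSc hx hy hne)).ne hxy
  rw [← Finset.sum_image (f := w) hinj]
  refine hS _ ?_
  rw [Finset.coe_image]
  rintro _ ⟨x, hx, rfl⟩ _ ⟨y, hy, rfl⟩ hxy
  exact ψ.map_adj (hSc hx hy fun h => hxy (h ▸ rfl))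

end FractionalIndependence

/-! ### The Lovász number and its variants. -/

section Theta

open Matrix

universe u

variable {V : Type u} {W : Type*} [Fintype V] [Fintype W] {G : SimpleGraph V}
  {H : SimpleGraph W}

omit [Fintype V] in
-- In Gram form, both sides are the squared norm of the sum of the columns of `B` selected by `f`.
theorem sum_submatrix_transpose_mul_self {K : Type*} [Fintype K] (B : Matrix K V ℝ) (f : W → V) :
    ∑ x, ∑ y, (Bᵀ * B) (f x) (f y) = ∑ k, (∑ x, B k (f x)) ^ 2 := by
  simp only [Matrix.mul_apply, Matrix.transpose_apply, sq, Finset.sum_mul_sum]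
  rw [Finset.sum_comm (s := (Finset.univ : Finset K))]
  exact Finset.sum_congr rfl fun x _ => Finset.sum_comm

theorem _root_.Matrix.PosSemidef.exists_eq_transpose_mul_self {X : Matrix V V ℝ}
    (hX : X.PosSemidef) : ∃ B : Matrix V V ℝ, X = Bᵀ * B := by
  classical
  open scoped MatrixOrder Matrix.Norms.L2Operator in
  obtain ⟨B, hB⟩ := CStarAlgebra.nonneg_iff_eq_star_mul_self.1 hX.nonneg
  exact ⟨B, by rw [hB, Matrix.star_eq_conjTranspose, Matrix.conjTranspose_eq_transpose_of_trivial]⟩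

theorem _root_.Matrix.PosSemidef.sum_nonneg {X : Matrix V V ℝ} (hX : X.PosSemidef) :
    0 ≤ ∑ u, ∑ v, X u v := by
  obtain ⟨B, rfl⟩ := hX.exists_eq_transpose_mul_self
  refine le_of_le_of_eq ?_ (sum_submatrix_transpose_mul_self B id).symm
  positivity

/-- Cauchy–Schwarz on each row of a Gram factor. This makes the suprema defining the theta numbers
finite. -/
theorem _root_.Matrix.PosSemidef.sum_le_card_mul_trace {X : Matrix V V ℝ} (hX : X.PosSemidef) :
    ∑ u, ∑ v, X u v ≤ Fintype.card V * X.trace := by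
  obtain ⟨B, rfl⟩ := hX.exists_eq_transpose_mul_self
  have hsum : ∑ u, ∑ v, (Bᵀ * B) u v = ∑ k, (∑ v, B k v) ^ 2 :=
    sum_submatrix_transpose_mul_self B id
  have htr : (Bᵀ * B).trace = ∑ k, ∑ v, B k v ^ 2 := by
    simp only [Matrix.trace, Matrix.diag_apply, Matrix.mul_apply, Matrix.transpose_apply, sq]
    exact Finset.sum_comm
  rw [hsum, htr, Finset.mul_sum]
  exact Finset.sum_le_sum fun k _ => sq_sum_le_card_mul_sum_sq

/-- Averaging a positive semidefinite matrix over the automorphisms of `G`, and pulling it back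
along a homomorphism. -/
theorem IsVertexTransitive.exists_posSemidef [Nonempty W] (hG : G.IsVertexTransitive)
    (φ : H →g G) {X : Matrix V V ℝ} (hX : X.PosSemidef) (htr : X.trace = 1) :
    ∃ (ι : Type u) (_ : Fintype ι) (ψ : ι → (H →g G)) (c : ℝ) (Y : Matrix W W ℝ), 0 ≤ c ∧
      (∀ x y, Y x y = c * ∑ i, X (ψ i x) (ψ i y)) ∧ Y.PosSemidef ∧ Y.trace = 1 ∧
      ∑ u, ∑ v, X u v ≤ (Fintype.card V : ℝ) / Fintype.card W * ∑ x, ∑ y, Y x y := by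
  have : Nonempty V := ‹Nonempty W›.map φ
  have : Finite (G ≃g G) := DFunLike.finite _
  have := Fintype.ofFinite (G ≃g G)
  have hA : (0 : ℝ) < Fintype.card (G ≃g G) := by exact_mod_cast Fintype.card_pos
  have hV : (0 : ℝ) < Fintype.card V := by exact_mod_cast Fintype.card_pos
  have hW : (0 : ℝ) < Fintype.card W := by exact_mod_cast Fintype.card_pos
  set a : ℝ := (Fintype.card (G ≃g G) : ℝ)
  set p : ℝ := (Fintype.card V : ℝ)
  set q : ℝ := (Fintype.card W : ℝ)
  -- The averaged pullback has trace `q / p`; the factor `p / q` restores trace `1`.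
  let Y : Matrix W W ℝ := (p / (a * q)) • ∑ σ : G ≃g G, X.submatrix (σ ∘ φ) (σ ∘ φ)
  have hY : ∀ x y, Y x y = p / (a * q) * ∑ σ : G ≃g G, X (σ (φ x)) (σ (φ y)) := fun x y => by
    simp [Y, Matrix.sum_apply]
  refine ⟨G ≃g G, inferInstance, fun σ => σ.toHom.comp φ, p / (a * q), Y, by positivity, hY,
    ?_, ?_, ?_⟩
  · exact (Matrix.posSemidef_sum _ fun σ _ => hX.submatrix _).smul (by positivity)
  · have h := hG.card_mul_sum_aut_sum (fun v => X v v) φ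
    have htr' : ∑ v, X v v = 1 := htr
    rw [htr', Finset.sum_comm] at h
    simp only [Matrix.trace, Matrix.diag_apply, hY]
    rw [← Finset.mul_sum, div_mul_eq_mul_div, h]
    simp only [a, p, q] at *
    field_simp
  · obtain ⟨B, rfl⟩ := hX.exists_eq_transpose_mul_self
    have hsum : ∑ x, ∑ y, Y x y =
        p / (a * q) * ∑ k, ∑ σ : G ≃g G, (∑ x, B k (σ (φ x))) ^ 2 := by
      simp only [hY, ← Finset.mul_sum]
      congr 1
      rw [Finset.sum_comm (s := (Finset.univ : Finset V))]
      simp only [← sum_submatrix_transpose_mul_self B fun x => _]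
      rw [Finset.sum_comm (s := (Finset.univ : Finset (G ≃g G)))]
      exact Finset.sum_congr rfl fun x _ => Finset.sum_comm
    -- For each row of `B`, the mean over `σ` of the squared sum is at least the square of its mean,
    -- which is `q / p` times the row sum.
    have hk : ∀ k, a * q ^ 2 * (∑ v, B k v) ^ 2 ≤
        p ^ 2 * ∑ σ : G ≃g G, (∑ x, B k (σ (φ x))) ^ 2 := fun k => by
      have h1 : (∑ σ : G ≃g G, ∑ x, B k (σ (φ x))) ^ 2 ≤
          a * ∑ σ : G ≃g G, (∑ x, B k (σ (φ x))) ^ 2 := sq_sum_le_card_mul_sum_sq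
      have h2 := hG.card_mul_sum_aut_sum (B k) φ
      refine le_of_mul_le_mul_left ?_ hA
      calc a * (a * q ^ 2 * (∑ v, B k v) ^ 2) = (a * (q * ∑ v, B k v)) ^ 2 := by ring
        _ = p ^ 2 * (∑ σ : G ≃g G, ∑ x, B k (σ (φ x))) ^ 2 := by rw [← h2]; ring
        _ ≤ p ^ 2 * (a * ∑ σ : G ≃g G, (∑ x, B k (σ (φ x))) ^ 2) := by gcongr
        _ = _ := by ring
    have h := Finset.sum_le_sum fun k (_ : k ∈ Finset.univ) => hk k
    rw [← Finset.mul_sum, ← Finset.mul_sum] at h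
    have hsum' : ∑ u, ∑ v, (Bᵀ * B) u v = ∑ k, (∑ v, B k v) ^ 2 :=
      sum_submatrix_transpose_mul_self B id
    rw [hsum, hsum', ← mul_assoc, div_mul_div_comm,
      div_mul_eq_mul_div, le_div_iff₀ (by positivity)]
    linarith

theorem bddAbove_sum_posSemidef (P : Matrix V V ℝ → Prop) :
    BddAbove {t : ℝ | ∃ X : Matrix V V ℝ, X.PosSemidef ∧ X.trace = 1 ∧ P X ∧
      t = ∑ u, ∑ v, X u v} := by
  refine ⟨Fintype.card V, ?_⟩
  rintro _ ⟨X, hX, htr, -, rfl⟩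
  simpa [htr] using hX.sum_le_card_mul_trace

theorem sSup_sum_posSemidef_nonneg (P : Matrix V V ℝ → Prop) :
    0 ≤ sSup {t : ℝ | ∃ X : Matrix V V ℝ, X.PosSemidef ∧ X.trace = 1 ∧ P X ∧
      t = ∑ u, ∑ v, X u v} := by
  refine Real.sSup_nonneg ?_
  rintro _ ⟨X, hX, -, -, rfl⟩
  exact hX.sum_nonneg

/-- Comparison of the values of two Lovász-type semidefinite programs whose additional constraints
are preserved by pulling back along homomorphisms and taking conic combinations. -/
theorem IsVertexTransitive.sSup_sum_posSemidef_div_le [Nonempty W] (hG : G.IsVertexTransitive)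
    (φ : H →g G) {P : Matrix V V ℝ → Prop} {Q : Matrix W W ℝ → Prop}
    (hPQ : ∀ {ι : Type u} [Fintype ι] (ψ : ι → (H →g G)) (c : ℝ) (X : Matrix V V ℝ)
      (Y : Matrix W W ℝ), 0 ≤ c → (∀ x y, Y x y = c * ∑ i, X (ψ i x) (ψ i y)) → P X → Q Y) :
    sSup {t : ℝ | ∃ X : Matrix V V ℝ, X.PosSemidef ∧ X.trace = 1 ∧ P X ∧
        t = ∑ u, ∑ v, X u v} /
      sSup {t : ℝ | ∃ Y : Matrix W W ℝ, Y.PosSemidef ∧ Y.trace = 1 ∧ Q Y ∧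
        t = ∑ u, ∑ v, Y u v} ≤ (Fintype.card V : ℝ) / Fintype.card W := by
  -- Nonnegativity of the denominator suffices, since division by `0` gives `0`.
  refine div_le_of_le_mul₀ (sSup_sum_posSemidef_nonneg Q) (by positivity)
    (Real.sSup_le ?_ (mul_nonneg (by positivity) (sSup_sum_posSemidef_nonneg Q)))
  rintro _ ⟨X, hX, htr, hP, rfl⟩
  obtain ⟨ι, _, ψ, c, Y, hc, hY, hYpos, hYtr, hle⟩ := hG.exists_posSemidef φ hX htr
  refine hle.trans (mul_le_mul_of_nonneg_left ?_ (by positivity))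
  exact le_csSup (bddAbove_sum_posSemidef Q) ⟨Y, hYpos, hYtr, hPQ ψ c X Y hc hY hP, rfl⟩

theorem IsVertexTransitive.lovaszTheta_div_le [Nonempty W] (hG : G.IsVertexTransitive)
    (φ : H →g G) :
    G.lovaszTheta / H.lovaszTheta ≤ (Fintype.card V : ℝ) / Fintype.card W := by
  refine hG.sSup_sum_posSemidef_div_le φ fun ψ c X Y _ hY hX u v huv => ?_
  simp [hY, hX _ _ ((ψ _).map_adj huv)]

theorem IsVertexTransitive.schrijverTheta_div_le [Nonempty W] (hG : G.IsVertexTransitive)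
    (φ : H →g G) :
    G.schrijverTheta / H.schrijverTheta ≤ (Fintype.card V : ℝ) / Fintype.card W := by
  have h := hG.sSup_sum_posSemidef_div_le φ
    (P := fun X => (∀ u v, G.Adj u v → X u v = 0) ∧ ∀ u v, 0 ≤ X u v)
    (Q := fun Y => (∀ u v, H.Adj u v → Y u v = 0) ∧ ∀ u v, 0 ≤ Y u v)
    fun ψ c X Y hc hY hX => ⟨fun u v huv => by simp [hY, hX.1 _ _ ((ψ _).map_adj huv)],
      fun u v => hY u v ▸ mul_nonneg hc (Finset.sum_nonneg fun i _ => hX.2 _ _)⟩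
  simpa only [schrijverTheta, and_assoc] using h

theorem IsVertexTransitive.szegedyTheta_div_le [Nonempty W] (hG : G.IsVertexTransitive)
    (φ : H →g G) :
    G.szegedyTheta / H.szegedyTheta ≤ (Fintype.card V : ℝ) / Fintype.card W := by
  refine hG.sSup_sum_posSemidef_div_le φ fun ψ c X Y hc hY hX u v huv => ?_
  rw [hY]
  exact mul_nonpos_of_nonneg_of_nonpos hc
    (Finset.sum_nonpos fun i _ => hX _ _ ((ψ i).map_adj huv))

end Theta

end SimpleGraph

theorem lemma6 {V W : Type*} [Fintype V] [Fintype W] [Nonempty W]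
    (G : SimpleGraph V) (H : SimpleGraph W)
    (hhom : Nonempty (H →g G)) (hG : G.IsVertexTransitive) :
    G.relFracIndepNum H ≤ (Fintype.card V : ENNReal) / (Fintype.card W : ENNReal) ∧
    (G.indepNum : ENNReal) / (H.indepNum : ENNReal) ≤ G.relFracIndepNum H ∧
    G.shannonCapacity / H.shannonCapacity ≤ (Fintype.card V : ℝ) / (Fintype.card W : ℝ) ∧
    G.fracIndepNum / H.fracIndepNum ≤ (Fintype.card V : ℝ) / (Fintype.card W : ℝ) ∧
    G.lovaszTheta / H.lovaszTheta ≤ (Fintype.card V : ℝ) / (Fintype.card W : ℝ) ∧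
    G.schrijverTheta / H.schrijverTheta ≤ (Fintype.card V : ℝ) / (Fintype.card W : ℝ) ∧
    G.szegedyTheta / H.szegedyTheta ≤ (Fintype.card V : ℝ) / (Fintype.card W : ℝ) := by
  obtain ⟨φ⟩ := hhom
  exact ⟨hG.relFracIndepNum_le φ, G.indepNum_div_le_relFracIndepNum H,
    div_le_of_le_mul₀ H.shannonCapacity_nonneg (by positivity) (hG.shannonCapacity_le φ),
    div_le_of_le_mul₀ H.fracIndepNum_nonneg (by positivity) (hG.fracIndepNum_le φ),
    hG.lovaszTheta_div_le φ, hG.schrijverTheta_div_le φ, hG.szegedyTheta_div_le φ⟩
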